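/- **Games.** For collections $\mathcal P,\mathcal Q$ of sets, $\mathsf G_1(\mathcal P,\mathcal Q)$ is the game in which, in each inning $n\in\omega$, One chooses $P_n\in\mathcal P$ and Two answers with $x_n\in P_n$; Two wins if $\{x_n:n\in\omega\}\in\mathcal Q$, and otherwise One wins. Strategies of One are functions of the finite sequence of Two's previous answers, with values in $\mathcal P$ (predetermined strategies depend only on the inning number); strategies of Two are functions of the finite sequence of One's moves so far, and always choose legal answers (Markov strategies depend only on One's last move and the inning number). Two games are *equivalent*, $\mathcal G\equiv\mathcal H$, if each of the following four statements holds for $\mathcal G$ exactly when it holds for $\mathcal H$: Two has a winning Markov strategy; Two has a winning strategy; One has no winning strategy; One has no winning predetermined strategy. **Notation.** For a space $Z$, let $\mathscr T_Z$ be the set of non-empty open sets $U\subsetneq Z$. For $z\in Z$ and $A\subseteq Z$ let $\mathscr N_{Z,z}=\{U\in\mathscr T_Z: z\in U\}$, $\mathscr N_Z(A)=\{U\in\mathscr T_Z:A\subseteq U\}$, $\mathscr N_Z[\mathcal A]=\{\mathscr N_Z(A):A\in\mathcal A\}$ and $\Omega_{Z,z}=\{D\subseteq Z: z\in\overline D\}$;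 let $\mathrm{CD}_Z$ be the set of closed discrete subsets of $Z$. Let $\mathcal O_Z(\mathcal B)$ be the set of open covers $\mathscr U$ of $Z$ with $\emptyset,Z\notin\mathscr U$ such that every $B\in\mathcal B$ is contained in some $U\in\mathscr U$. By $\neg\mathcal Q$ we mean the collection of sets (of points of the game) not in $\mathcal Q$. An *ideal of closed sets* of $X$ is a family of non-empty closed subsets of $X$ that is closed under binary unions, contains every singleton, and does not contain $X$. The space $X$ is *functionally $\mathcal A$-normal* if, whenever $A\in\mathcal A$ and $U\supseteq A$ is open, there is a continuous $f:X\to\mathbb R$ with $f=0$ on $A$ and $f=1$ on $X\setminus U$. A map $\Phi$ from $X$ to the non-empty compact subsets of $\mathbb R$ is *usco* if $\{x\in X:\Phi(x)\subseteq V\}$ is open for every open $V\subseteq\mathbb R$, and *minimal usco* if, moreover, its graph does not properly contain the graph of another usco map. $MU_{\mathcal A}(X)$ is the set of minimal usco maps, and $C_{\mathcal A}(X)$ the set of continuous functions $X\to\mathbb R$, each with the topology of uniform convergence on the members of $\mathcal A$; for $MU_{\mathcal A}(X)$ this is the topology of the uniformity with base $$\{(\Phi,\Psi):\ \Phi(x)\subseteq\mathbb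 B(\Psi(x),\varepsilon)\text{ and }\Psi(x)\subseteq\mathbb B(\Phi(x),\varepsilon)\text{ for all }x\in A\}\qquad(A\in\mathcal A,\ \varepsilon>0),$$ where $\mathbb B(Y,\varepsilon)=\bigcup_{y\in Y}(y-\varepsilon,y+\varepsilon)$. $\mathbf 0$ is the constant map $\{0\}$, respectively the constant function $0$. **Corollary 3.6.** Let $\mathcal A$ and $\mathcal B$ be ideals of closed sets of a topological space $X$. If $X$ is functionally $\mathcal A$-normal and every member of $\mathcal B$ is sequentially compact, then $$\begin{aligned} \mathsf G_1(\mathscr N_X[\mathcal A],\neg\mathcal O_X(\mathcal B)) &\equiv\mathsf G_1(\mathscr N_{MU_{\mathcal A}(X),\mathbf 0},\neg\Omega_{MU_{\mathcal B}(X),\mathbf 0}) \equiv\mathsf G_1(\mathscr N_{C_{\mathcal A}(X),\mathbf 0},\neg\Omega_{C_{\mathcal B}(X),\mathbf 0})\\ &\equiv\mathsf G_1(\mathscr T_{MU_{\mathcal A}(X)},\neg\Omega_{MU_{\mathcal B}(X),\mathbf 0}) \equiv\mathsf G_1(\mathscr T_{C_{\mathcal A}(X)},\neg\Omega_{C_{\mathcal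 B}(X),\mathbf 0})\\ &\equiv\mathsf G_1(\mathscr T_{MU_{\mathcal A}(X)},\mathrm{CD}_{MU_{\mathcal B}(X)}) \equiv\mathsf G_1(\mathscr T_{C_{\mathcal A}(X)},\mathrm{CD}_{C_{\mathcal B}(X)}). \end{aligned}$$ -/

import Mathlib

open Set TopologicalSpace
open scoped Topology

universe u v

/-! ### Single-selection games -/

/-- The single-selection game `G₁(𝒜, ℬ)` on points of type `α`. In inning `n : ℕ`, One chooses
`A n ∈ 𝒜` and Two answers with `x n ∈ A n`; Two wins iff `{x n : n ∈ ℕ} ∈ ℬ`. -/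
structure SelectionGame (α : Type u) where
  /-- the class `𝒜` of legal moves of One -/
  moves : Set (Set α)
  /-- the class `ℬ` of sets that are winning for Two -/
  target : Set (Set α)

namespace SelectionGame

variable {α : Type u} {β : Type v}

/-- The finite sequence `⟨x 0, …, x (n - 1)⟩`. -/
def initial {γ : Type u} (x : ℕ → γ) (n : ℕ) : List γ := (List.range n).map x

/-- `I ↑ G`: One has a winning full-information strategy `σ : (⋃ 𝒜)^{<ω} → 𝒜`. -/
def OneWins (G : SelectionGame α) : Prop :=
  ∃ σ : List ↥(⋃₀ G.moves) → ↥G.moves,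
    ∀ x : ℕ → ↥(⋃₀ G.moves),
      (∀ n, (x n : α) ∈ (σ (initial x n) : Set α)) →
        range (fun n => (x n : α)) ∉ G.target

/-- `II ↑ G`: Two has a winning full-information strategy `τ : 𝒜^{<ω} → ⋃ 𝒜`; Two's answers have
to be legal, and the set of the answers has to be in the target. -/
def TwoWins (G : SelectionGame α) : Prop :=
  ∃ τ : List ↥G.moves → ↥(⋃₀ G.moves),
    ∀ A : ℕ → ↥G.moves,
      (∀ n, (τ (initial A (n + 1)) : α) ∈ (A n : Set α)) ∧
        range (fun n => (τ (initial A (n + 1)) : α)) ∈ G.target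

/-- `I ↑_pre G`: One has a winning predetermined strategy `σ : ω → 𝒜`. -/
def OneWinsPre (G : SelectionGame α) : Prop :=
  ∃ σ : ℕ → ↥G.moves,
    ∀ x : ℕ → α, (∀ n, x n ∈ (σ n : Set α)) → range x ∉ G.target

/-- `II ↑_mark G`: Two has a winning Markov strategy `τ : 𝒜 × ω → ⋃ 𝒜`. -/
def TwoWinsMark (G : SelectionGame α) : Prop :=
  ∃ τ : ↥G.moves × ℕ → ↥(⋃₀ G.moves),
    ∀ A : ℕ → ↥G.moves,
      (∀ n, (τ (A n, n) : α) ∈ (A n : Set α)) ∧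
        range (fun n => (τ (A n, n) : α)) ∈ G.target

/-- Equivalence of selection games. -/
structure Equivalent (G : SelectionGame α) (H : SelectionGame β) : Prop where
  twoMark : G.TwoWinsMark ↔ H.TwoWinsMark
  two : G.TwoWins ↔ H.TwoWins
  one : ¬ G.OneWins ↔ ¬ H.OneWins
  onePre : ¬ G.OneWinsPre ↔ ¬ H.OneWinsPre

end SelectionGame

/-! ### Families of sets in a space

The topology is an explicit argument, because the games below use two topologies on one set. -/

section Families

variable {Z : Type u} (t : TopologicalSpace Z)

/-- `𝒯_Z`: the proper non-empty open sets. -/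
def properOpens : Set (Set Z) := {U | IsOpen[t] U ∧ U.Nonempty ∧ U ≠ univ}

/-- `𝒩_{Z,z}`: the members of `𝒯_Z` that contain the point `z`. -/
def pointNhds (z : Z) : Set (Set Z) := {U | U ∈ properOpens t ∧ z ∈ U}

/-- `𝒩_Z(A)`: the members of `𝒯_Z` that contain the set `A`. -/
def setNhds (A : Set Z) : Set (Set Z) := {U | U ∈ properOpens t ∧ A ⊆ U}

/-- `𝒩_Z[𝒜] = {𝒩_Z(A) : A ∈ 𝒜}`. -/
def setNhdsFamily (𝒜 : Set (Set Z)) : Set (Set (Set Z)) := setNhds t '' 𝒜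

/-- `Ω_{Z,z}`: the sets that have `z` in their closure. -/
def clusterSets (z : Z) : Set (Set Z) := {D | z ∈ @closure Z t D}

/-- `CD_Z`: the closed discrete sets. -/
def closedDiscreteSets : Set (Set Z) := {D | IsClosed[t] D ∧ @IsDiscrete Z t D}

/-- `𝒪_Z(𝒜)`: the non-trivial open covers `𝒰` (neither `∅` nor `Z` is in `𝒰`) such that every
`A ∈ 𝒜` lies in some member of `𝒰`. -/
def idealCovers (𝒜 : Set (Set Z)) : Set (Set (Set Z)) :=
  {𝒰 | (∀ U ∈ 𝒰, IsOpen[t] U) ∧ ⋃₀ 𝒰 = univ ∧ ∅ ∉ 𝒰 ∧ univ ∉ 𝒰 ∧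
    ∀ A ∈ 𝒜, ∃ U ∈ 𝒰, A ⊆ U}

end Families

/-- Ideals of closed sets: families of non-empty closed sets, closed under binary unions, that
contain all singletons and do not contain the whole space. -/
structure IsClosedIdeal {X : Type u} [TopologicalSpace X] (𝒜 : Set (Set X)) : Prop where
  nonempty : ∀ A ∈ 𝒜, A.Nonempty
  isClosed : ∀ A ∈ 𝒜, IsClosed A
  union_mem : ∀ A ∈ 𝒜, ∀ B ∈ 𝒜, A ∪ B ∈ 𝒜
  singleton_mem : ∀ x : X, {x} ∈ 𝒜
  univ_notMem : univ ∉ 𝒜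

/-- `X` is functionally `𝒜`-normal: if `A ∈ 𝒜` lies in an open set `U`, then some continuous
`f : X → ℝ` is `0` on `A` and `1` off `U`. -/
def FunctionallyNormal {X : Type u} [TopologicalSpace X] (𝒜 : Set (Set X)) : Prop :=
  ∀ A ∈ 𝒜, ∀ U : Set X, IsOpen U → A ⊆ U →
    ∃ f : X → ℝ, Continuous f ∧ (∀ x ∈ A, f x = 0) ∧ ∀ x ∉ U, f x = 1

/-! ### Minimal usco maps -/

/-- Usco maps: upper semicontinuous maps with non-empty compact values. -/
def IsUsco {X : Type u} {Y : Type v} [TopologicalSpace X] [TopologicalSpace Y]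
    (Φ : X → NonemptyCompacts Y) : Prop :=
  ∀ V : Set Y, IsOpen V → IsOpen {x | (Φ x : Set Y) ⊆ V}

/-- Minimal usco maps: the usco maps whose graph is minimal with respect to inclusion among the
graphs of usco maps. The order on `X → NonemptyCompacts Y` is pointwise inclusion, which is
inclusion of graphs. -/
def IsMinimalUsco {X : Type u} {Y : Type v} [TopologicalSpace X] [TopologicalSpace Y]
    (Φ : X → NonemptyCompacts Y) : Prop :=
  Minimal IsUsco Φ

/-- `MU(X)`: the set of minimal usco maps from `X` to `ℝ`. -/
def MU (X : Type u) [TopologicalSpace X] : Type u :=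
  {Φ : X → NonemptyCompacts ℝ // IsMinimalUsco Φ}

theorem isMinimalUsco_zero (X : Type u) [TopologicalSpace X] :
    IsMinimalUsco (fun _ : X => ({0} : NonemptyCompacts ℝ)) := by
  refine ⟨fun V _ => isOpen_const, fun Ψ _ h x => ?_⟩
  intro y hy
  obtain ⟨z, hz⟩ := (Ψ x).nonempty
  have hz0 : z ∈ ({0} : NonemptyCompacts ℝ) := h x hz
  rw [NonemptyCompacts.mem_singleton] at hy hz0
  rw [hy, ← hz0]
  exact hz

/-- The point `𝟎` of `MU(X)`: the map with constant value `{0}`. -/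
def MU.zero (X : Type u) [TopologicalSpace X] : MU X :=
  ⟨fun _ => {0}, isMinimalUsco_zero X⟩

/-- The topology of `MU_𝒜(X)`: uniform convergence on the members of `𝒜`, where `ℝ` has its usual
uniformity and `NonemptyCompacts ℝ` has the Hausdorff uniformity, which is generated by the sets
`{(K, L) | K ⊆ E[L] ∧ L ⊆ E[K]}` for `E` a (symmetric) entourage of `ℝ`. -/
abbrev MU.topology {X : Type u} [TopologicalSpace X] (𝒜 : Set (Set X)) : TopologicalSpace (MU X) :=
  TopologicalSpace.induced (fun Φ : MU X => UniformOnFun.ofFun 𝒜 Φ.1)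
    (UniformOnFun.topologicalSpace X (NonemptyCompacts ℝ) 𝒜)

/-- The topology of `C_𝒜(X)`: uniform convergence on the members of `𝒜`, on the set `C(X, ℝ)` of
all continuous real-valued functions. -/
abbrev contTopology {X : Type u} [TopologicalSpace X] (𝒜 : Set (Set X)) :
    TopologicalSpace C(X, ℝ) :=
  TopologicalSpace.induced (fun f : C(X, ℝ) => UniformOnFun.ofFun 𝒜 (f : X → ℝ))
    (UniformOnFun.topologicalSpace X ℝ 𝒜)

/-! ### The games -/

section Games

variable {X : Type u} [t : TopologicalSpace X] (𝒜 ℬ : Set (Set X))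

/-- The generalized point-open game `G₁(𝒩_X[𝒜], ¬ 𝒪_X(ℬ))`. -/
def pointOpenGame : SelectionGame (Set X) :=
  ⟨setNhdsFamily t 𝒜, (idealCovers t ℬ)ᶜ⟩

/-- `G₁(𝒩_{MU_𝒜(X),𝟎}, ¬ Ω_{MU_ℬ(X),𝟎})`. -/
def clusterGameMU : SelectionGame (MU X) :=
  ⟨pointNhds (MU.topology 𝒜) (MU.zero X), (clusterSets (MU.topology ℬ) (MU.zero X))ᶜ⟩

/-- `G₁(𝒩_{C_𝒜(X),𝟎}, ¬ Ω_{C_ℬ(X),𝟎})`. -/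
def clusterGameC : SelectionGame C(X, ℝ) :=
  ⟨pointNhds (contTopology 𝒜) 0, (clusterSets (contTopology ℬ) 0)ᶜ⟩

/-- `G₁(𝒯_{MU_𝒜(X)}, ¬ Ω_{MU_ℬ(X),𝟎})`. -/
def openGameMU : SelectionGame (MU X) :=
  ⟨properOpens (MU.topology 𝒜), (clusterSets (MU.topology ℬ) (MU.zero X))ᶜ⟩

/-- `G₁(𝒯_{C_𝒜(X)}, ¬ Ω_{C_ℬ(X),𝟎})`. -/
def openGameC : SelectionGame C(X, ℝ) :=
  ⟨properOpens (contTopology 𝒜), (clusterSets (contTopology ℬ) 0)ᶜ⟩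

/-- `G₁(𝒯_{MU_𝒜(X)}, CD_{MU_ℬ(X)})`. -/
def closedDiscreteGameMU : SelectionGame (MU X) :=
  ⟨properOpens (MU.topology 𝒜), closedDiscreteSets (MU.topology ℬ)⟩

/-- `G₁(𝒯_{C_𝒜(X)}, CD_{C_ℬ(X)})`. -/
def closedDiscreteGameC : SelectionGame C(X, ℝ) :=
  ⟨properOpens (contTopology 𝒜), closedDiscreteSets (contTopology ℬ)⟩

end Games

/-! Both function spaces are treated at once, as sets of usco maps containing `𝟎` and stable under
`Φ ↦ (1 - h) Φ + c h` (`UscoSpace`). For each of them wins travel in cycles: from the point-open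
game to the open or the closed discrete game, on to the cluster game, and back. Each link translates
moves and answers inning by inning (`transfersTo_of_translation`), so it preserves all four kinds of
strategy. From sets to functions, functional normality lets Two keep a function on a set `A ∈ 𝒜`
given by One's open move and give it the value `n + 1` off the open set `U n`. If the `U n` do not
cover `ℬ`, some `B ∈ ℬ` meets every complement, so the functions take the values `n + 1` on `B`:
they stay away from `𝟎`, and by sequential compactness of `B` they form a closed discrete set. From
functions to sets, Two plays the open set where the values of the function are smaller than `2⁻ⁿ`.
-/

/-! ### Transfer of wins between games -/

namespace SelectionGame

variable {α : Type*} {β : Type*} {γ : Type*}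

/-- Every kind of win of Two in `G` yields the same kind of win in `H`. -/
structure TransfersTo (G : SelectionGame α) (H : SelectionGame β) : Prop where
  twoMark : G.TwoWinsMark → H.TwoWinsMark
  two : G.TwoWins → H.TwoWins
  one : H.OneWins → G.OneWins
  onePre : H.OneWinsPre → G.OneWinsPre

theorem TransfersTo.trans {G : SelectionGame α} {H : SelectionGame β} {K : SelectionGame γ}
    (h₁ : G.TransfersTo H) (h₂ : H.TransfersTo K) : G.TransfersTo K :=
  ⟨h₂.twoMark ∘ h₁.twoMark, h₂.two ∘ h₁.two, h₁.one ∘ h₂.one, h₁.onePre ∘ h₂.onePre⟩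

theorem TransfersTo.equivalent {G : SelectionGame α} {H : SelectionGame β}
    (h₁ : G.TransfersTo H) (h₂ : H.TransfersTo G) : G.Equivalent H :=
  ⟨⟨h₁.twoMark, h₂.twoMark⟩, ⟨h₁.two, h₂.two⟩, not_congr ⟨h₂.one, h₁.one⟩,
    not_congr ⟨h₂.onePre, h₁.onePre⟩⟩

theorem initial_succ {γ : Type*} (x : ℕ → γ) (n : ℕ) :
    initial x (n + 1) = initial x n ++ [x n] := by
  simp [initial, List.range_succ]

theorem length_initial {γ : Type*} (x : ℕ → γ) (n : ℕ) : (initial x n).length = n := by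
  simp [initial]

theorem mapIdx_initial {γ δ : Type*} (f : ℕ → γ → δ) (x : ℕ → γ) (n : ℕ) :
    (initial x n).mapIdx f = initial (fun k => f k (x k)) n := by
  apply List.ext_getElem <;> simp [initial]

/-- The answers in `H` that correspond to the answers `L` in `G`, when One follows `σ` in `H`. -/
def translateAnswers {γ δ ε : Type*} (σ : List δ → ε) (g : ℕ → ε → γ → δ) (L : List γ) : List δ :=
  L.foldl (fun acc x => acc ++ [g acc.length (σ acc) x]) []

theorem translateAnswers_initial {γ δ ε : Type*} (σ : List δ → ε) (g : ℕ → ε → γ → δ) (x : ℕ → γ)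
    (n : ℕ) : translateAnswers σ g (initial x n) =
      initial (fun k => g k (σ (translateAnswers σ g (initial x k))) (x k)) n := by
  induction n with
  | zero => rfl
  | succ n ih =>
    have h : (translateAnswers σ g (initial x n)).length = n := by rw [ih, length_initial]
    rw [initial_succ (fun k => g k (σ (translateAnswers σ g (initial x k))) (x k)), ← ih,
      initial_succ x]
    conv_lhs => rw [translateAnswers, List.foldl_append]
    change translateAnswers σ g (initial x n) ++
      [g (translateAnswers σ g (initial x n)).length _ _] = _
    rw [h]
    rfl

/-- One's moves go from `H` to `G` by `f` and Two's answers come back by `g`. Both see only the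
inning and the current move, which is what keeps Markov and predetermined strategies Markov and
predetermined. -/
theorem transfersTo_of_translation {G : SelectionGame α} {H : SelectionGame β}
    (hne : (⋃₀ H.moves).Nonempty) (f : ℕ → ↥H.moves → ↥G.moves) (g : ℕ → ↥H.moves → α → β)
    (hmem : ∀ n B, ∀ x ∈ (f n B : Set α), g n B x ∈ (B : Set β))
    (htarget : ∀ (B : ℕ → ↥H.moves) (x : ℕ → α), (∀ n, x n ∈ (f n (B n) : Set α)) →
      range x ∈ G.target → range (fun n => g n (B n) (x n)) ∈ H.target) :
    G.TransfersTo H := by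
  classical
  obtain ⟨b₀, hb₀⟩ := hne
  -- Strategies must be total; the junk value `b₀` is never reached in a legal play.
  let tot : β → ↥(⋃₀ H.moves) := fun b => if h : b ∈ ⋃₀ H.moves then ⟨b, h⟩ else ⟨b₀, hb₀⟩
  have htot : ∀ (B : ↥H.moves) (b : β), b ∈ (B : Set β) → (tot b : β) = b := by
    intro B b hb
    have : b ∈ ⋃₀ H.moves := mem_sUnion.2 ⟨B, B.2, hb⟩
    simp only [tot, dif_pos this]
  refine ⟨?_, ?_, ?_, ?_⟩
  · rintro ⟨τ, hτ⟩
    refine ⟨fun p => tot (g p.2 p.1 (τ (f p.2 p.1, p.2))), fun B => ?_⟩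
    obtain ⟨h₁, h₂⟩ := hτ (fun n => f n (B n))
    have h₃ : ∀ n, (tot (g n (B n) (τ (f n (B n), n))) : β) = g n (B n) (τ (f n (B n), n)) :=
      fun n => htot (B n) _ (hmem n _ _ (h₁ n))
    simp only [h₃]
    exact ⟨fun n => hmem n _ _ (h₁ n), htarget B _ h₁ h₂⟩
  · rintro ⟨τ, hτ⟩
    refine ⟨fun L => if h : L = [] then ⟨b₀, hb₀⟩ else
      tot (g (L.length - 1) (L.getLast h) (τ (L.mapIdx f))), fun B => ?_⟩
    obtain ⟨h₁, h₂⟩ := hτ (fun n => f n (B n))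
    have hL : ∀ n, initial B (n + 1) ≠ [] := fun n => by simp [initial_succ]
    have hlast : ∀ n, (initial B (n + 1)).getLast (hL n) = B n := fun n => by
      simp [initial_succ]
    have h₃ : ∀ n, (tot (g n (B n) (τ (initial (fun n => f n (B n)) (n + 1)))) : β) =
        g n (B n) (τ (initial (fun n => f n (B n)) (n + 1))) :=
      fun n => htot (B n) _ (hmem n _ _ (h₁ n))
    simp only [dif_neg (hL _), hlast, length_initial, mapIdx_initial, Nat.add_sub_cancel, h₃]
    exact ⟨fun n => hmem n _ _ (h₁ n), htarget B _ h₁ h₂⟩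
  · rintro ⟨σ, hσ⟩
    let g' : ℕ → ↥H.moves → ↥(⋃₀ G.moves) → ↥(⋃₀ H.moves) := fun n B x => tot (g n B x)
    refine ⟨fun L => f L.length (σ (translateAnswers σ g' L)), fun x hx hxt => ?_⟩
    simp only [length_initial] at hx
    let B : ℕ → ↥H.moves := fun n => σ (translateAnswers σ g' (initial x n))
    have h₃ : ∀ n, (g' n (B n) (x n) : β) = g n (B n) (x n) :=
      fun n => htot (B n) _ (hmem n _ _ (hx n))
    refine hσ (fun n => g' n (B n) (x n)) (fun n => ?_) ?_
    · rw [← translateAnswers_initial, h₃]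
      exact hmem n _ _ (hx n)
    · simp only [h₃]
      exact htarget B _ hx hxt
  · rintro ⟨σ, hσ⟩
    refine ⟨fun n => f n (σ n), fun x hx hxt => ?_⟩
    exact hσ _ (fun n => hmem n _ _ (hx n)) (htarget σ x hx hxt)

/-- Without moves, Markov strategies of Two win vacuously, while the other three kinds of strategy
do not exist: each would have to produce an element of an empty type. -/
theorem transfersTo_of_moves_eq_empty {G : SelectionGame α} {H : SelectionGame β}
    (hG : G.moves = ∅) (hH : H.moves = ∅) : G.TransfersTo H := by
  have : IsEmpty ↥H.moves := by rw [hH]; infer_instance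
  have : IsEmpty ↥(⋃₀ G.moves) := by rw [hG, sUnion_empty]; infer_instance
  refine ⟨fun _ => ⟨fun p => isEmptyElim p.1, fun A => isEmptyElim (A 0)⟩, ?_, ?_, ?_⟩
  · rintro ⟨τ, -⟩
    exact isEmptyElim (τ [])
  · rintro ⟨σ, -⟩
    exact isEmptyElim (σ [])
  · rintro ⟨σ, -⟩
    exact isEmptyElim (σ 0)

end SelectionGame

/-! ### Usco maps -/

section Usco

variable {X : Type*} [TopologicalSpace X]

theorem isUsco_iff_eventually {Y : Type*} [TopologicalSpace Y] {Φ : X → NonemptyCompacts Y} :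
    IsUsco Φ ↔ ∀ x, ∀ V : Set Y, IsOpen V → (Φ x : Set Y) ⊆ V → ∀ᶠ x' in 𝓝 x, (Φ x' : Set Y) ⊆ V :=
  ⟨fun h _ V hV hx => (h V hV).mem_nhds hx,
    fun h V hV => isOpen_iff_mem_nhds.2 fun x hx => h x V hV hx⟩

/-- Compactness of `Φ x` enters through the tube lemma. Continuity is asked only at the points over
`x`, so that `F` may involve a division. -/
theorem IsUsco.eventually_image_subset {Y Y' : Type*} [TopologicalSpace Y] [TopologicalSpace Y']
    {Φ : X → NonemptyCompacts Y} (hΦ : IsUsco Φ) {F : X → Y → Y'} {x : X}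
    (hF : ∀ y ∈ Φ x, ContinuousAt (Function.uncurry F) (x, y)) {V : Set Y'} (hV : IsOpen V)
    (hx : F x '' Φ x ⊆ V) : ∀ᶠ x' in 𝓝 x, F x' '' Φ x' ⊆ V := by
  have hsub : ({x} : Set X) ×ˢ (Φ x : Set Y) ⊆ interior (Function.uncurry F ⁻¹' V) := by
    rintro ⟨x', y⟩ ⟨rfl, hy⟩
    exact mem_interior_iff_mem_nhds.2
      ((hF y hy).preimage_mem_nhds (hV.mem_nhds (hx (mem_image_of_mem _ hy))))
  obtain ⟨u, w, hu, hw, hxu, hyw, huw⟩ := generalized_tube_lemma isCompact_singleton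
    (Φ x).isCompact isOpen_interior hsub
  filter_upwards [hu.mem_nhds (singleton_subset_iff.1 hxu), (hΦ w hw).mem_nhds hyw] with x' h₁ h₂
  rintro _ ⟨y, hy, rfl⟩
  have h₃ := interior_subset (huw (mk_mem_prod h₁ (h₂ hy)))
  exact h₃

theorem isUsco_singleton {f : X → ℝ} (hf : Continuous f) :
    IsUsco (fun x => ({f x} : NonemptyCompacts ℝ)) := by
  intro V hV
  simp only [NonemptyCompacts.coe_singleton, singleton_subset_iff]
  exact hV.preimage hf

/-- The usco map `(1 - h) Φ + c h`. -/
noncomputable def interpolate (h : C(X, ℝ)) (c : ℝ) (Φ : X → NonemptyCompacts ℝ) (x : X) :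
    NonemptyCompacts ℝ :=
  (Φ x).map (fun y => (1 - h x) * y + c * h x) (by fun_prop)

theorem coe_interpolate (h : C(X, ℝ)) (c : ℝ) (Φ : X → NonemptyCompacts ℝ) (x : X) :
    (interpolate h c Φ x : Set ℝ) = (fun y => (1 - h x) * y + c * h x) '' Φ x :=
  NonemptyCompacts.coe_map _ _

theorem interpolate_of_eq_zero {h : C(X, ℝ)} {x : X} (hx : h x = 0) (c : ℝ)
    (Φ : X → NonemptyCompacts ℝ) : interpolate h c Φ x = Φ x :=
  SetLike.coe_injective (by simp [coe_interpolate, hx])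

theorem interpolate_of_eq_one {h : C(X, ℝ)} {x : X} (hx : h x = 1) (c : ℝ)
    (Φ : X → NonemptyCompacts ℝ) : interpolate h c Φ x = {c} :=
  SetLike.coe_injective (by simp [coe_interpolate, hx, (Φ x).nonempty.image_const])

theorem IsUsco.interpolate (h : C(X, ℝ)) (c : ℝ) {Φ : X → NonemptyCompacts ℝ} (hΦ : IsUsco Φ) :
    IsUsco (interpolate h c Φ) := by
  refine isUsco_iff_eventually.2 fun x V hV hx => ?_
  simp only [coe_interpolate] at hx ⊢
  refine hΦ.eventually_image_subset (F := fun x y => (1 - h x) * y + c * h x) ?_ hV hx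
  intro y _
  apply Continuous.continuousAt
  unfold Function.uncurry
  fun_prop

/-- Where `h ≠ 1` the affine map is invertible, so a smaller usco map `Ψ` pulls back to an usco map
below `Φ`, which minimality forces to equal `Φ`. Where `h = 1` the value is a singleton and cannot
shrink. -/
theorem IsMinimalUsco.interpolate (h : C(X, ℝ)) (c : ℝ) {Φ : X → NonemptyCompacts ℝ}
    (hΦ : IsMinimalUsco Φ) : IsMinimalUsco (interpolate h c Φ) := by
  classical
  refine ⟨hΦ.1.interpolate h c, fun Ψ hΨ hle => ?_⟩
  let G : X → ℝ → ℝ := fun x y => (y - c * h x) / (1 - h x)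
  let Φ' : X → NonemptyCompacts ℝ := fun x =>
    if h x = 1 then Φ x else (Ψ x).map (G x) (by fun_prop)
  have hΦ'1 : ∀ x, h x = 1 → Φ' x = Φ x := fun x hx => if_pos hx
  have hΦ'2 : ∀ x, h x ≠ 1 → (Φ' x : Set ℝ) = G x '' Ψ x := fun x hx => by
    simp only [Φ', if_neg hx, NonemptyCompacts.coe_map]
  have hle' : Φ' ≤ Φ := by
    intro x
    by_cases hx : h x = 1
    · rw [hΦ'1 x hx]
    · rw [← SetLike.coe_subset_coe, hΦ'2 x hx]
      rintro _ ⟨y, hy, rfl⟩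
      have hy' : y ∈ (_root_.interpolate h c Φ x : Set ℝ) := hle x hy
      rw [coe_interpolate] at hy'
      obtain ⟨w, hw, rfl⟩ := hy'
      have : 1 - h x ≠ 0 := sub_ne_zero.2 (Ne.symm hx)
      have hG : G x ((1 - h x) * w + c * h x) = w := by
        simp only [G]
        field_simp
        ring
      simpa only [hG] using hw
  have husco : IsUsco Φ' := by
    refine isUsco_iff_eventually.2 fun x V hV hxV => ?_
    -- The inverse blows up near points with `h x = 1`, but there `Φ' ≤ Φ` and semicontinuity of `Φ`
    -- suffice.
    by_cases hx : h x = 1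
    · rw [hΦ'1 x hx] at hxV
      filter_upwards [(hΦ.1 V hV).mem_nhds hxV] with x' hx'
      exact (SetLike.coe_subset_coe.2 (hle' x')).trans hx'
    · rw [hΦ'2 x hx] at hxV
      have hne : ∀ᶠ x' in 𝓝 x, h x' ≠ 1 :=
        h.continuous.continuousAt.eventually_ne hx
      have hcont : ∀ y ∈ Ψ x, ContinuousAt (Function.uncurry G) (x, y) := by
        intro y _
        have : ContinuousAt (fun p : X × ℝ => (p.2 - c * h p.1) / (1 - h p.1)) (x, y) := by
          apply ContinuousAt.div
          · fun_prop
          · fun_prop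
          · exact sub_ne_zero.2 (Ne.symm hx)
        exact this
      filter_upwards [hne, hΨ.eventually_image_subset hcont hV hxV] with x' h₁ h₂
      rwa [hΦ'2 x' h₁]
  have hge : Φ ≤ Φ' := hΦ.2 husco hle'
  intro x
  by_cases hx : h x = 1
  · have hs := hle x
    rw [interpolate_of_eq_one hx] at hs ⊢
    intro y hy
    obtain ⟨z, hz⟩ := (Ψ x).nonempty
    have hz' := hs hz
    rw [NonemptyCompacts.mem_singleton] at hy hz'
    rw [hy, ← hz']
    exact hz
  · rw [← SetLike.coe_subset_coe, coe_interpolate]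
    rintro _ ⟨w, hw, rfl⟩
    have hw' : w ∈ (Φ' x : Set ℝ) := hge x hw
    rw [hΦ'2 x hx] at hw'
    obtain ⟨y, hy, rfl⟩ := hw'
    have : 1 - h x ≠ 0 := sub_ne_zero.2 (Ne.symm hx)
    have hF : (1 - h x) * G x y + c * h x = y := by
      simp only [G]
      field_simp
      ring
    simpa only [hF] using hy

/-- Usco maps are bounded on sequentially compact sets. -/
theorem IsUsco.exists_bound {Φ : X → NonemptyCompacts ℝ} (hΦ : IsUsco Φ) {B : Set X}
    (hB : IsSeqCompact B) : ∃ M : ℝ, ∀ x ∈ B, ∀ y ∈ Φ x, y ≤ M := by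
  by_contra! hcon
  choose x hx y hy hlt using fun n : ℕ => hcon n
  -- Near the limit `a` the values stay below `M + 1`, yet `y (φ k) > φ k ≥ k`.
  obtain ⟨a, -, φ, hφ, hlim⟩ := hB hx
  obtain ⟨M, hM⟩ := (Φ a).isCompact.bddAbove
  have hev : ∀ᶠ x' in 𝓝 a, (Φ x' : Set ℝ) ⊆ Iio (M + 1) :=
    (hΦ _ isOpen_Iio).mem_nhds fun z hz => lt_of_le_of_lt (hM hz) (lt_add_one M)
  obtain ⟨k, hk₁, hk₂⟩ := ((hlim.eventually hev).and
    (Filter.eventually_ge_atTop ⌈M + 1⌉₊)).exists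
  have h₁ : y (φ k) < M + 1 := hk₁ (hy (φ k))
  have h₂ : M + 1 ≤ (φ k : ℝ) :=
    (Nat.le_ceil _).trans (Nat.cast_le.2 (hk₂.trans hφ.le_apply))
  linarith [hlt (φ k)]

end Usco

/-! ### Spaces of usco maps -/

/-- A set `Z` of usco maps that contains `𝟎` and is closed under `Φ ↦ (1 - h) Φ + c h`. -/
structure UscoSpace (X : Type u) [TopologicalSpace X] (Z : Type v) where
  /-- the usco map of a point -/
  val : Z → X → NonemptyCompacts ℝ
  val_injective : Function.Injective val
  isUsco : ∀ z, IsUsco (val z)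
  /-- the constant map `{0}` -/
  zero : Z
  val_zero : ∀ x, val zero x = {0}
  exists_interpolate : ∀ z (h : C(X, ℝ)) (c : ℝ), ∃ z', val z' = interpolate h c (val z)

theorem IsClosedIdeal.directedOn {X : Type*} [TopologicalSpace X] {𝒜 : Set (Set X)}
    (h𝒜 : IsClosedIdeal 𝒜) : DirectedOn (· ⊆ ·) 𝒜 :=
  fun A hA B hB => ⟨A ∪ B, h𝒜.union_mem A hA B hB, subset_union_left, subset_union_right⟩

theorem IsClosedIdeal.sUnion_eq {X : Type*} [TopologicalSpace X] {𝒜 : Set (Set X)}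
    (h𝒜 : IsClosedIdeal 𝒜) : ⋃₀ 𝒜 = univ :=
  eq_univ_of_forall fun x => mem_sUnion.2 ⟨{x}, h𝒜.singleton_mem x, rfl⟩

theorem IsClosedIdeal.union_finite_mem {X : Type*} [TopologicalSpace X] {𝒜 : Set (Set X)}
    (h𝒜 : IsClosedIdeal 𝒜) {A F : Set X} (hA : A ∈ 𝒜) (hF : F.Finite) : A ∪ F ∈ 𝒜 := by
  induction F, hF using Set.Finite.induction_on with
  | empty => simpa using hA
  | @insert a s _ _ ih =>
    have := h𝒜.union_mem _ ih _ (h𝒜.singleton_mem a)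
    rwa [union_assoc, union_singleton] at this

theorem IsClosedIdeal.setNhds_nonempty {X : Type*} [t : TopologicalSpace X] {𝒜 : Set (Set X)}
    (h𝒜 : IsClosedIdeal 𝒜) {A : Set X} (hA : A ∈ 𝒜) : (setNhds t A).Nonempty := by
  obtain ⟨x, hx⟩ := (ne_univ_iff_exists_notMem A).1 (fun h => h𝒜.univ_notMem (h ▸ hA))
  have hsub : A ⊆ {x}ᶜ := fun y hy h => hx (h ▸ hy)
  exact ⟨{x}ᶜ, ⟨(h𝒜.isClosed _ (h𝒜.singleton_mem x)).isOpen_compl,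
    (h𝒜.nonempty A hA).mono hsub, by simp⟩, hsub⟩

namespace UscoSpace

variable {X : Type u} [t : TopologicalSpace X] {Z : Type v} (M : UscoSpace X Z)
  {𝒜 ℬ : Set (Set X)}

/-- The topology of uniform convergence on the members of `𝒜`. -/
abbrev topology (𝒜 : Set (Set X)) : TopologicalSpace Z :=
  TopologicalSpace.induced (fun z : Z => UniformOnFun.ofFun 𝒜 (M.val z))
    (UniformOnFun.topologicalSpace X (NonemptyCompacts ℝ) 𝒜)

theorem hasBasis_nhds [Nonempty X] (h𝒜 : IsClosedIdeal 𝒜) (z : Z) :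
    (@nhds Z (M.topology 𝒜) z).HasBasis (fun p : Set X × ℝ => p.1 ∈ 𝒜 ∧ 0 < p.2)
      (fun p => {z' | ∀ x ∈ p.1, dist (M.val z' x) (M.val z x) < p.2}) := by
  have hne : 𝒜.Nonempty := ⟨_, h𝒜.singleton_mem (Classical.arbitrary X)⟩
  have hb := UniformOnFun.hasBasis_nhds_of_basis X (NonemptyCompacts ℝ) 𝒜
    (UniformOnFun.ofFun 𝒜 (M.val z)) hne h𝒜.directedOn Metric.uniformity_basis_dist
  rw [nhds_induced]
  exact hb.comap _

theorem t1Space (h𝒜 : IsClosedIdeal 𝒜) : @T1Space Z (M.topology 𝒜) := by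
  let _ := M.topology 𝒜
  have : T2Space (UniformOnFun X (NonemptyCompacts ℝ) 𝒜) :=
    UniformOnFun.t2Space_of_covering h𝒜.sUnion_eq
  have hinj : Function.Injective (fun z : Z => UniformOnFun.ofFun 𝒜 (M.val z)) :=
    (UniformOnFun.ofFun 𝒜).injective.comp M.val_injective
  have := T2Space.of_injective_continuous hinj continuous_induced_dom
  infer_instance

theorem exists_const (c : ℝ) : ∃ z, ∀ x, M.val z x = {c} := by
  obtain ⟨z, hz⟩ := M.exists_interpolate M.zero (ContinuousMap.const X 1) c
  exact ⟨z, fun x => by rw [hz, interpolate_of_eq_one rfl]⟩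

theorem dist_singleton (a b : ℝ) :
    dist ({a} : NonemptyCompacts ℝ) {b} = dist a b :=
  NonemptyCompacts.isometry_singleton.dist_eq a b

theorem exists_dist_lt {K L : NonemptyCompacts ℝ} {r : ℝ} (h : dist K L < r) {y : ℝ}
    (hy : y ∈ K) : ∃ y' ∈ L, dist y y' < r :=
  Metric.exists_dist_lt_of_hausdorffDist_lt hy h
    (Metric.hausdorffEDist_ne_top_of_nonempty_of_bounded K.nonempty L.nonempty
      K.isCompact.isBounded L.isCompact.isBounded)

theorem dist_zero_le {K : NonemptyCompacts ℝ} {r : ℝ} (hr : 0 ≤ r)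
    (h : ∀ y ∈ K, |y| ≤ r) : dist K {0} ≤ r := by
  refine Metric.hausdorffDist_le_of_mem_dist hr (fun y hy => ⟨0, by simp, ?_⟩) fun y hy => ?_
  · simpa using h y hy
  · obtain ⟨w, hw⟩ := K.nonempty
    refine ⟨w, hw, ?_⟩
    have : y = 0 := by simpa using hy
    simpa [this] using h w hw

/-! ### Games on a space of usco maps -/

/-- `G₁(𝒩_{Z,𝟎}, ¬ Ω_{Z,𝟎})`. -/
abbrev clusterGame (𝒜 ℬ : Set (Set X)) : SelectionGame Z :=
  ⟨pointNhds (M.topology 𝒜) M.zero, (clusterSets (M.topology ℬ) M.zero)ᶜ⟩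

/-- `G₁(𝒯_Z, ¬ Ω_{Z,𝟎})`. -/
abbrev openGame (𝒜 ℬ : Set (Set X)) : SelectionGame Z :=
  ⟨properOpens (M.topology 𝒜), (clusterSets (M.topology ℬ) M.zero)ᶜ⟩

/-- `G₁(𝒯_Z, CD_Z)`. -/
abbrev closedDiscreteGame (𝒜 ℬ : Set (Set X)) : SelectionGame Z :=
  ⟨properOpens (M.topology 𝒜), closedDiscreteSets (M.topology ℬ)⟩

/-- The interior of a basic neighbourhood of `𝟎` is a legal move. -/
theorem exists_pointNhds_subset [Nonempty X] (h𝒜 : IsClosedIdeal 𝒜) {A : Set X} (hA : A ∈ 𝒜)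
    {ε : ℝ} (hε : 0 < ε) : ∃ W ∈ pointNhds (M.topology 𝒜) M.zero,
      ∀ z ∈ W, ∀ x ∈ A, dist (M.val z x) {0} < ε := by
  let _ := M.topology 𝒜
  have hmem := (M.hasBasis_nhds h𝒜 M.zero).mem_of_mem (i := (A, ε)) ⟨hA, hε⟩
  simp only [M.val_zero] at hmem
  refine ⟨interior {z' | ∀ x ∈ A, dist (M.val z' x) {0} < ε},
    ⟨⟨isOpen_interior, ⟨_, mem_interior_iff_mem_nhds.2 hmem⟩, fun h => ?_⟩,
      mem_interior_iff_mem_nhds.2 hmem⟩, fun z hz => interior_subset hz⟩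
  obtain ⟨z, hz⟩ := M.exists_const ε
  obtain ⟨x, hx⟩ := h𝒜.nonempty A hA
  have h₁ : z ∈ {z' | ∀ x ∈ A, dist (M.val z' x) {0} < ε} :=
    interior_subset (h.symm ▸ mem_univ z)
  have h₂ := h₁ x hx
  rw [hz, dist_singleton, Real.dist_0_eq_abs, abs_of_pos hε] at h₂
  exact lt_irrefl _ h₂

theorem sUnion_pointNhds_nonempty [Nonempty X] (h𝒜 : IsClosedIdeal 𝒜) :
    (⋃₀ pointNhds (M.topology 𝒜) M.zero).Nonempty := by
  obtain ⟨W, hW, -⟩ := M.exists_pointNhds_subset h𝒜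
    (h𝒜.singleton_mem (Classical.arbitrary X)) one_pos
  exact ⟨M.zero, mem_sUnion.2 ⟨W, hW, hW.2⟩⟩

theorem sUnion_properOpens_nonempty [Nonempty X] (h𝒜 : IsClosedIdeal 𝒜) :
    (⋃₀ properOpens (M.topology 𝒜)).Nonempty :=
  (M.sUnion_pointNhds_nonempty h𝒜).mono (sUnion_subset_sUnion fun _ h => h.1)

theorem openGame_transfersTo_clusterGame [Nonempty X] (h𝒜 : IsClosedIdeal 𝒜) :
    (M.openGame 𝒜 ℬ).TransfersTo (M.clusterGame 𝒜 ℬ) :=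
  SelectionGame.transfersTo_of_translation (M.sUnion_pointNhds_nonempty h𝒜)
    (fun _ W => ⟨W, W.2.1⟩) (fun _ _ z => z) (fun _ _ _ h => h) (fun _ _ _ h => h)

/-- Deleting `𝟎` from One's move keeps Two's answers away from it, and a closed set missing `𝟎` does
not cluster there. -/
theorem closedDiscreteGame_transfersTo_clusterGame [Nonempty X] (h𝒜 : IsClosedIdeal 𝒜) :
    (M.closedDiscreteGame 𝒜 ℬ).TransfersTo (M.clusterGame 𝒜 ℬ) := by
  have hmove : ∀ W ∈ pointNhds (M.topology 𝒜) M.zero,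
      W \ {M.zero} ∈ properOpens (M.topology 𝒜) := by
    let _ := M.topology 𝒜
    have := M.t1Space h𝒜
    rintro W ⟨⟨hW, -, hWu⟩, h0⟩
    refine ⟨hW.sdiff isClosed_singleton, ?_, fun h => hWu (univ_subset_iff.1 (h ▸ sdiff_subset))⟩
    obtain ⟨⟨A, ε⟩, ⟨-, hε⟩, hsub⟩ := (M.hasBasis_nhds h𝒜 M.zero).mem_iff.1 (hW.mem_nhds h0)
    -- A small nonzero constant shows that `𝟎` is not isolated.
    obtain ⟨z, hz⟩ := M.exists_const (ε / 2)
    refine ⟨z, hsub fun x _ => ?_, fun h => ?_⟩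
    · rw [hz, M.val_zero, dist_singleton, Real.dist_0_eq_abs, abs_of_pos (half_pos hε)]
      exact half_lt_self hε
    · have h₁ := hz (Classical.arbitrary X)
      rw [mem_singleton_iff.1 h, M.val_zero] at h₁
      have h₂ := dist_singleton 0 (ε / 2)
      rw [← h₁, dist_self, dist_comm, Real.dist_0_eq_abs, abs_of_pos (half_pos hε)] at h₂
      exact (half_pos hε).ne h₂
  refine SelectionGame.transfersTo_of_translation (M.sUnion_pointNhds_nonempty h𝒜)
    (fun _ W => ⟨W \ {M.zero}, hmove W W.2⟩) (fun _ _ z => z) (fun _ _ _ h => h.1) ?_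
  rintro W z hz ⟨hcl, -⟩ h0
  let _ := M.topology ℬ
  obtain ⟨n, hn⟩ := hcl.closure_subset h0
  exact (hz n).2 hn

/-- If Two's sets covered `ℬ`, each `S ∈ ℬ` would lie in `U n (z n)` for arbitrarily large `n`, so
the functions `z n` would cluster at `𝟎`. -/
theorem clusterGame_transfersTo_pointOpenGame [Nonempty X] (h𝒜 : IsClosedIdeal 𝒜)
    (hℬ : IsClosedIdeal ℬ) :
    (M.clusterGame 𝒜 ℬ).TransfersTo (pointOpenGame 𝒜 ℬ) := by
  classical
  have hpow : ∀ n : ℕ, (0 : ℝ) < (1 / 2) ^ n := fun n => by positivity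
  choose A hA hAeq using fun B : ↥(setNhdsFamily t 𝒜) => B.2
  choose W hW hWA using fun (n : ℕ) (B : ↥(setNhdsFamily t 𝒜)) =>
    M.exists_pointNhds_subset h𝒜 (hA B) (hpow n)
  choose D hD using fun B : ↥(setNhdsFamily t 𝒜) => h𝒜.setNhds_nonempty (hA B)
  let U : ℕ → Z → Set X := fun n z => {x | (M.val z x : Set ℝ) ⊆ Metric.ball 0 ((1 / 2) ^ n)}
  have hUo : ∀ n z, IsOpen (U n z) := fun n z => M.isUsco z _ Metric.isOpen_ball
  have hUdist : ∀ n z, ∀ x ∈ U n z, dist (M.val z x) {0} ≤ (1 / 2) ^ n := fun n z x hx =>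
    dist_zero_le (hpow n).le fun y hy => by simpa using (mem_ball_zero_iff.1 (hx hy)).le
  have hne : (⋃₀ setNhdsFamily t 𝒜).Nonempty := by
    obtain ⟨V, hV⟩ := h𝒜.setNhds_nonempty (h𝒜.singleton_mem (Classical.arbitrary X))
    exact ⟨V, mem_sUnion.2 ⟨_, mem_image_of_mem _ (h𝒜.singleton_mem _), hV⟩⟩
  -- The whole space is not a legal answer; `D B` is a legal substitute when `U n z` is everything.
  refine SelectionGame.transfersTo_of_translation hne (fun n B => ⟨W n B, hW n B⟩)
    (fun n B z => if U n z = univ then D B else U n z) ?_ ?_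
  · intro n B z hz
    suffices h : (if U n z = univ then D B else U n z) ∈ setNhds t (A B) from (hAeq B).subset h
    split_ifs with hu
    · exact hD B
    · have hsub : A B ⊆ U n z := by
        intro x hx y hy
        obtain ⟨y', hy', hlt⟩ := exists_dist_lt (hWA n B z hz x hx) hy
        rw [NonemptyCompacts.mem_singleton] at hy'
        rwa [Metric.mem_ball, ← hy']
      exact ⟨⟨hUo n z, (h𝒜.nonempty _ (hA B)).mono hsub, hu⟩, hsub⟩
  · intro B z hz hclus hcov
    apply hclus
    let V : ℕ → Set X := fun n => if U n (z n) = univ then D (B n) else U n (z n)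
    replace hcov : range V ∈ idealCovers t ℬ := hcov
    obtain ⟨-, -, -, hnu, hBcov⟩ := hcov
    have hVne : ∀ n, ∃ x, x ∉ V n := fun n =>
      (ne_univ_iff_exists_notMem _).1 fun h => hnu ⟨n, h⟩
    choose p hp using hVne
    let _ := M.topology ℬ
    refine (mem_closure_iff_nhds_basis (M.hasBasis_nhds hℬ M.zero)).2 ?_
    rintro ⟨S, ε⟩ ⟨hS, hε⟩
    obtain ⟨N, hN⟩ := exists_pow_lt_of_lt_one hε (by norm_num : (1 / 2 : ℝ) < 1)
    have key : ∃ n, N ≤ n ∧ S ⊆ U n (z n) := by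
      -- Adding to `S` a point outside each of the first `N` sets forces the covering index to be at
      -- least `N`.
      obtain ⟨_, ⟨n, rfl⟩, hn⟩ := hBcov _ (hℬ.union_finite_mem hS
        ((finite_Iio N).image p))
      refine ⟨n, ?_, ?_⟩
      · by_contra! hlt
        exact hp n (hn (Or.inr ⟨n, hlt, rfl⟩))
      · by_cases hu : U n (z n) = univ
        · rw [hu]; exact subset_univ _
        · have : V n = U n (z n) := if_neg hu
          exact this ▸ (subset_union_left.trans hn)
    obtain ⟨n, hn, hSU⟩ := key
    refine ⟨z n, mem_range_self n, fun x hx => ?_⟩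
    rw [M.val_zero]
    calc dist (M.val (z n) x) {0} ≤ (1 / 2) ^ n := hUdist n _ x (hSU hx)
      _ ≤ (1 / 2) ^ N := pow_le_pow_of_le_one (by norm_num) (by norm_num) hn
      _ < ε := hN

/-- Two's win in the point-open game transfers to every game on `𝒯_Z` whose target contains the
sequences that are unbounded on some member of `ℬ`. -/
theorem pointOpenGame_transfersTo [Nonempty X] (h𝒜 : IsClosedIdeal 𝒜) (hℬ : IsClosedIdeal ℬ)
    (hnormal : FunctionallyNormal 𝒜) {T : Set (Set Z)}
    (hT : ∀ B ∈ ℬ, ∀ z : ℕ → Z, (∀ n : ℕ, ∃ x ∈ B, M.val (z n) x = {(n : ℝ) + 1}) →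
      range z ∈ T) :
    (pointOpenGame 𝒜 ℬ).TransfersTo ⟨properOpens (M.topology 𝒜), T⟩ := by
  have hbase : ∀ W : ↥(properOpens (M.topology 𝒜)), ∃ z, ∃ A ∈ 𝒜,
      ∀ z', (∀ x ∈ A, M.val z' x = M.val z x) → z' ∈ (W : Set Z) := by
    let _ := M.topology 𝒜
    rintro ⟨W, hW, ⟨z, hz⟩, -⟩
    obtain ⟨⟨A, ε⟩, ⟨hA, hε⟩, hsub⟩ := (M.hasBasis_nhds h𝒜 z).mem_iff.1 (hW.mem_nhds hz)
    refine ⟨z, A, hA, fun z' hz' => hsub fun x hx => ?_⟩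
    rw [hz' x hx, dist_self]
    exact hε
  choose z₀ A hA hAW using hbase
  have hans : ∀ (n : ℕ) (W : ↥(properOpens (M.topology 𝒜))) (U : Set X), ∃ z,
      U ∈ setNhds t (A W) → (∀ x ∈ A W, M.val z x = M.val (z₀ W) x) ∧
        ∀ x ∉ U, M.val z x = {(n : ℝ) + 1} := by
    intro n W U
    by_cases hU : U ∈ setNhds t (A W)
    · obtain ⟨h, hcont, h0, h1⟩ := hnormal (A W) (hA W) U hU.1.1 hU.2
      obtain ⟨z, hz⟩ := M.exists_interpolate (z₀ W) ⟨h, hcont⟩ ((n : ℝ) + 1)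
      refine ⟨z, fun _ => ⟨fun x hx => ?_, fun x hx => ?_⟩⟩
      · rw [hz, interpolate_of_eq_zero (h0 x hx)]
      · rw [hz, interpolate_of_eq_one (h1 x hx)]
    · exact ⟨z₀ W, fun h => absurd h hU⟩
  choose g hg using hans
  refine SelectionGame.transfersTo_of_translation (M.sUnion_properOpens_nonempty h𝒜)
    (fun _ W => ⟨setNhds t (A W), mem_image_of_mem _ (hA W)⟩) g
    (fun n W U hU => hAW W _ (hg n W U hU).1) ?_
  intro W U hU hncov
  -- The `U n` are proper non-empty open sets, so they can fail to be a cover in the required sense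
  -- only by missing a member of `ℬ`.
  have hB : ∃ B ∈ ℬ, ∀ n, ¬ B ⊆ U n := by
    by_contra! hcon
    refine hncov ⟨?_, ?_, ?_, ?_, ?_⟩
    · rintro _ ⟨n, rfl⟩
      exact (hU n).1.1
    · refine eq_univ_of_forall fun x => ?_
      obtain ⟨n, hn⟩ := hcon _ (hℬ.singleton_mem x)
      exact mem_sUnion.2 ⟨U n, mem_range_self n, hn rfl⟩
    · rintro ⟨n, hn⟩
      exact (hU n).1.2.1.ne_empty hn
    · rintro ⟨n, hn⟩
      exact (hU n).1.2.2 hn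
    · intro B hB
      obtain ⟨n, hn⟩ := hcon B hB
      exact ⟨U n, mem_range_self n, hn⟩
  obtain ⟨B, hB, hBU⟩ := hB
  refine hT B hB _ fun n => ?_
  obtain ⟨x, hxB, hxU⟩ := not_subset.1 (hBU n)
  exact ⟨x, hxB, (hg n (W n) (U n) (hU n)).2 x hxU⟩

theorem pointOpenGame_transfersTo_openGame [Nonempty X] (h𝒜 : IsClosedIdeal 𝒜)
    (hℬ : IsClosedIdeal ℬ) (hnormal : FunctionallyNormal 𝒜) :
    (pointOpenGame 𝒜 ℬ).TransfersTo (M.openGame 𝒜 ℬ) := by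
  refine M.pointOpenGame_transfersTo h𝒜 hℬ hnormal fun B hB z hz hcl => ?_
  let _ := M.topology ℬ
  obtain ⟨_, ⟨n, rfl⟩, hn⟩ :=
    (mem_closure_iff_nhds_basis (M.hasBasis_nhds hℬ M.zero)).1 hcl (B, 1) ⟨hB, one_pos⟩
  obtain ⟨x, hxB, hx⟩ := hz n
  have h := hn x hxB
  rw [hx, M.val_zero, dist_singleton, Real.dist_0_eq_abs, abs_of_pos (by positivity)] at h
  linarith [(Nat.cast_nonneg n : (0 : ℝ) ≤ n)]

theorem pointOpenGame_transfersTo_closedDiscreteGame [Nonempty X] (h𝒜 : IsClosedIdeal 𝒜)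
    (hℬ : IsClosedIdeal ℬ) (hnormal : FunctionallyNormal 𝒜) (hseq : ∀ B ∈ ℬ, IsSeqCompact B) :
    (pointOpenGame 𝒜 ℬ).TransfersTo (M.closedDiscreteGame 𝒜 ℬ) := by
  refine M.pointOpenGame_transfersTo h𝒜 hℬ hnormal fun B hB z hz => ?_
  let _ := M.topology ℬ
  have := M.t1Space hℬ
  -- With `w` bounded above by `b` on `B`, a function `z n` within distance `1` of `w` on `B` has `n
  -- < b`.
  have hfin : ∀ w : Z, ∃ N ∈ 𝓝 w, (N ∩ range z).Finite := by
    intro w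
    obtain ⟨b, hb⟩ := (M.isUsco w).exists_bound (hseq B hB)
    refine ⟨_, (M.hasBasis_nhds hℬ w).mem_of_mem (i := (B, 1)) ⟨hB, one_pos⟩,
      ((finite_Iio ⌈b⌉₊).image z).subset ?_⟩
    rintro _ ⟨hn, n, rfl⟩
    refine ⟨n, ?_, rfl⟩
    obtain ⟨x, hxB, hx⟩ := hz n
    have hd := hn x hxB
    rw [hx] at hd
    obtain ⟨y, hy, hlt⟩ := exists_dist_lt hd ((NonemptyCompacts.mem_singleton _ _).2 rfl)
    rw [Real.dist_eq] at hlt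
    have h₁ : (n : ℝ) + 1 - y < 1 := (abs_lt.1 hlt).2
    have h₂ := hb x hxB y hy
    exact Nat.lt_ceil.2 (by linarith)
  -- By `T1`, the finitely many members of the range near `w` and different from it can be removed.
  have hdisj : ∀ w : Z, Disjoint (𝓝[≠] w) (Filter.principal (range z)) := by
    intro w
    obtain ⟨N, hN, hNf⟩ := hfin w
    rw [Filter.disjoint_principal_right, mem_nhdsWithin_iff_exists_mem_nhds_inter]
    refine ⟨N ∩ ((N ∩ range z) \ {w})ᶜ, Filter.inter_mem hN
      ((hNf.subset sdiff_subset).isClosed.isOpen_compl.mem_nhds fun h => h.2 rfl), ?_⟩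
    rintro v ⟨⟨hvN, hv⟩, hvw⟩ hvz
    exact hv ⟨⟨hvN, hvz⟩, hvw⟩
  exact isClosed_and_discrete_iff.2 hdisj

theorem moves_eq_empty [IsEmpty X] (𝒜 : Set (Set X)) : properOpens (M.topology 𝒜) = ∅ := by
  have : Subsingleton Z := M.val_injective.subsingleton
  refine eq_empty_of_forall_notMem fun W hW => hW.2.2 (Subsingleton.eq_univ_of_nonempty hW.2.1)

end UscoSpace

/-- The space of minimal usco maps. -/
def uscoSpaceMU (X : Type u) [TopologicalSpace X] : UscoSpace X (MU X) where
  val Φ := Φ.1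
  val_injective := Subtype.val_injective
  isUsco Φ := Φ.2.1
  zero := MU.zero X
  val_zero _ := rfl
  exists_interpolate Φ h c := ⟨⟨_, Φ.2.interpolate h c⟩, rfl⟩

/-- The space of continuous functions, viewed as single-valued usco maps. -/
def uscoSpaceC (X : Type u) [TopologicalSpace X] : UscoSpace X C(X, ℝ) where
  val f x := {f x}
  val_injective f g h := by
    ext x
    exact NonemptyCompacts.singleton_injective (congrFun h x)
  isUsco f := isUsco_singleton f.continuous
  zero := 0
  val_zero _ := rfl
  exists_interpolate f h c :=
    ⟨(1 - h) * f + ContinuousMap.const X c * h, by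
      funext x
      apply SetLike.coe_injective
      simp [coe_interpolate]⟩

/-- The map `a ↦ {a}` is a uniform embedding into the Hausdorff uniformity, so it does not change
uniform convergence. -/
theorem contTopology_eq {X : Type u} [TopologicalSpace X] (𝒜 : Set (Set X)) :
    contTopology 𝒜 = (uscoSpaceC X).topology 𝒜 := by
  have h := (UniformOnFun.postcomp_isUniformInducing (α := X) (𝔖 := 𝒜)
    (NonemptyCompacts.isUniformEmbedding_singleton (α := ℝ)).isUniformInducing).isInducing.eq_induced
  exact (congrArg (TopologicalSpace.induced _) h).trans induced_compose

namespace UscoSpace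

variable {X : Type u} [t : TopologicalSpace X] {Z : Type v} (M : UscoSpace X Z)
  {𝒜 ℬ : Set (Set X)}

/-- The point-open game and the three games on a space of usco maps are equivalent. -/
theorem transfersTo_all (h𝒜 : IsClosedIdeal 𝒜) (hℬ : IsClosedIdeal ℬ)
    (hnormal : FunctionallyNormal 𝒜) (hseq : ∀ B ∈ ℬ, IsSeqCompact B) :
    ((pointOpenGame 𝒜 ℬ).TransfersTo (M.clusterGame 𝒜 ℬ) ∧
      (M.clusterGame 𝒜 ℬ).TransfersTo (pointOpenGame 𝒜 ℬ)) ∧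
    ((pointOpenGame 𝒜 ℬ).TransfersTo (M.openGame 𝒜 ℬ) ∧
      (M.openGame 𝒜 ℬ).TransfersTo (pointOpenGame 𝒜 ℬ)) ∧
    ((pointOpenGame 𝒜 ℬ).TransfersTo (M.closedDiscreteGame 𝒜 ℬ) ∧
      (M.closedDiscreteGame 𝒜 ℬ).TransfersTo (pointOpenGame 𝒜 ℬ)) := by
  -- Over the empty space `𝒜` is empty and `Z` has at most one point, so One has no move in any of
  -- the games.
  rcases isEmpty_or_nonempty X with hX | hX
  · have h₁ : (pointOpenGame 𝒜 ℬ).moves = ∅ := by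
      have : 𝒜 = ∅ := eq_empty_of_forall_notMem fun A hA =>
        isEmptyElim (h𝒜.nonempty A hA).some
      simp [pointOpenGame, setNhdsFamily, this]
    have h₂ : properOpens (M.topology 𝒜) = ∅ := M.moves_eq_empty 𝒜
    have h₃ : pointNhds (M.topology 𝒜) M.zero = ∅ :=
      subset_empty_iff.1 (h₂ ▸ fun _ h => h.1)
    refine ⟨⟨?_, ?_⟩, ⟨?_, ?_⟩, ⟨?_, ?_⟩⟩ <;>
      exact SelectionGame.transfersTo_of_moves_eq_empty (by assumption) (by assumption)
  · have h₁ := M.clusterGame_transfersTo_pointOpenGame h𝒜 hℬ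
    have h₂ := M.pointOpenGame_transfersTo_openGame h𝒜 hℬ hnormal
    have h₃ := M.pointOpenGame_transfersTo_closedDiscreteGame h𝒜 hℬ hnormal hseq
    have h₄ := M.openGame_transfersTo_clusterGame (ℬ := ℬ) h𝒜
    have h₅ := M.closedDiscreteGame_transfersTo_clusterGame (ℬ := ℬ) h𝒜
    exact ⟨⟨h₂.trans h₄, h₁⟩, ⟨h₂, h₄.trans h₁⟩, ⟨h₃, h₅.trans h₁⟩⟩

end UscoSpace

theorem corollary3p6 {X : Type u} [TopologicalSpace X] (𝒜 ℬ : Set (Set X))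
    (h𝒜 : IsClosedIdeal 𝒜) (hℬ : IsClosedIdeal ℬ)
    (hnormal : FunctionallyNormal 𝒜) (hseq : ∀ B ∈ ℬ, IsSeqCompact B) :
    (pointOpenGame 𝒜 ℬ).Equivalent (clusterGameMU 𝒜 ℬ) ∧
    (clusterGameMU 𝒜 ℬ).Equivalent (clusterGameC 𝒜 ℬ) ∧
    (clusterGameC 𝒜 ℬ).Equivalent (openGameMU 𝒜 ℬ) ∧
    (openGameMU 𝒜 ℬ).Equivalent (openGameC 𝒜 ℬ) ∧
    (openGameC 𝒜 ℬ).Equivalent (closedDiscreteGameMU 𝒜 ℬ) ∧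
    (closedDiscreteGameMU 𝒜 ℬ).Equivalent (closedDiscreteGameC 𝒜 ℬ) := by
  have hC₁ : clusterGameC 𝒜 ℬ = (uscoSpaceC X).clusterGame 𝒜 ℬ := by
    simp only [clusterGameC, contTopology_eq]; rfl
  have hC₂ : openGameC 𝒜 ℬ = (uscoSpaceC X).openGame 𝒜 ℬ := by
    simp only [openGameC, contTopology_eq]; rfl
  have hC₃ : closedDiscreteGameC 𝒜 ℬ = (uscoSpaceC X).closedDiscreteGame 𝒜 ℬ := by
    simp only [closedDiscreteGameC, contTopology_eq]
  obtain ⟨⟨a₁, a₂⟩, ⟨b₁, b₂⟩, ⟨c₁, c₂⟩⟩ :=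
    (uscoSpaceC X).transfersTo_all h𝒜 hℬ hnormal hseq
  rw [← hC₁] at a₁ a₂
  rw [← hC₂] at b₁ b₂
  rw [← hC₃] at c₁ c₂
  obtain ⟨⟨p₁, p₂⟩, ⟨q₁, q₂⟩, ⟨r₁, r₂⟩⟩ :=
    (uscoSpaceMU X).transfersTo_all h𝒜 hℬ hnormal hseq
  exact ⟨p₁.equivalent p₂, (p₂.trans a₁).equivalent (a₂.trans p₁),
    (a₂.trans q₁).equivalent (q₂.trans a₁), (q₂.trans b₁).equivalent (b₂.trans q₁),
    (b₂.trans r₁).equivalent (r₂.trans b₁), (r₂.trans c₁).equivalent (c₂.trans r₁)⟩
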